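/- Let $\mathbb{V}=(\Omega,\le,\otimes,\mathsf{k})$ be a commutative unital quantale (a complete lattice with a commutative monoid structure $(\Omega,\otimes,\mathsf k)$ whose tensor distributes over arbitrary joins) that is integral ($\mathsf k=\top$), cointegral ($\varepsilon\otimes\delta=\bot$ implies $\varepsilon=\bot$ or $\delta=\bot$), non-trivial ($\mathsf k\ne\bot$) and continuous ($\varepsilon=\bigvee\{\delta\mid\delta\ll\varepsilon\}$ for all $\varepsilon$, where $\delta\ll\varepsilon$ means: whenever $\varepsilon\le\bigvee A$, there is a finite $A_0\subseteq A$ with $\delta\le\bigvee A_0$). Let $X$ be a countably infinite set of variables. For $\Omega$-valued relations on a set $A$, i.e. maps $R,S:A\times A\to\Omega$, ordered pointwise, put $(R;S)(a,c)=\bigvee_b R(a,b)\otimes S(b,c)$, $R^\circ(b,a)=R(a,b)$, $\Delta(a,a)=\mathsf k$ and $\Delta(a,b)=\bot$ for $a\neq b$, $R^0=\Delta$, $R^{n+1}=R;R^n$, and $R^*=\bigvee_n R^n$. $R$ is *confluent* if $(R^*)^\circ;R^*\le R^*;(R^*)^\circ$; it is *locally confluent on* $(a,b)$ if $(R^\circ;R)(a,b)\le(R^*;(R^*)^\circ)(a,b)$,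 and *locally confluent* if this holds for all $(a,b)$; it is *terminating* if there is no infinite sequence $(a_i)_{i\in\mathbb N}$ with $R(a_0,a_1)\otimes\cdots\otimes R(a_{n-1},a_n)\ne\bot$ for all $n$. A *$\mathbb V$-term rewriting system* consists of a signature $\Sigma$ and a set of rules $a\mapsto^{\varepsilon}b$, with $a,b$ $\Sigma$-terms over $X$ and $\varepsilon\in\Omega$, such that $a\mapsto^\varepsilon b$ and $\delta\le\varepsilon$ imply $a\mapsto^\delta b$. It generates the least ternary relation $\to$ such that: $C[a^\sigma]\to^{\varepsilon}C[b^\sigma]$ for all rules $a\mapsto^\varepsilon b$, one-hole contexts $C$ and substitutions $\sigma$; if $e\to^\varepsilon f$ and $\delta\le\varepsilon$, then $e\to^\delta f$; if $e\to^{\varepsilon_i}f$ for $i=1,\dots,n$ with $n\geq 1$, then $e\to^{\bigvee_i\varepsilon_i}f$; if $e\to^\delta f$ for all $\delta\ll\varepsilon$, then $e\to^\varepsilon f$. Its rewriting relation is $R(e,f)=\bigvee\{\varepsilon\mid e\to^\varepsilon f\}$; the system is called confluent, locally confluent or terminating if $R$ is. The system is *linear* if in each rule no variable occurs more than once in the left-hand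 side, and none more than once in the right-hand side. Let $c_1\mapsto^\varepsilon d_1$ and $c_2\mapsto^\delta d_2$ be renamings of rules without common variables, and let $p$ be a position of $c_2$ carrying a function symbol such that $c_2|_p$ and $c_1$ are unifiable; if $p$ is the root, suppose moreover that $(c_1,d_1)$ and $(c_2,d_2)$ are not variable renamings of each other. If $\sigma$ is a most general unifier of $c_2|_p$ and $c_1$, then $(c_2^\sigma[d_1^\sigma]_p,\,d_2^\sigma)$ is a *critical pair*. The system is *locally confluent on its critical pairs* if $R$ is locally confluent on each critical pair. **Theorem.** 1. Every linear and terminating $\mathbb V$-term rewriting system that is locally confluent on its critical pairs is confluent. 2. Every linear $\mathbb V$-term rewriting system in which each variable of the right-hand side of a rule of weight $\neq\bot$ also occurs in its left-hand side, and which is locally confluent on its critical pairs, is locally confluent. 3. Linearity cannot be dropped if $\mathbb V$ is not idempotent: if $\varepsilon\otimes\varepsilon\ne\varepsilon$ for some $\varepsilon\in\Omega$, then there is a non-linear terminating $\mathbb V$-term rewriting system satisfying the variable condition of (2) that is locally confluent on its critical pairs, but neither locally confluent nor confluent. -/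

import Mathlib

universe u v w

/-! ### Quantales

A commutative unital quantale is a type `Ω` with `[CommMonoid Ω] [CompleteLattice Ω] [IsQuantale Ω]`;
the tensor is `*` and its unit is `1`. -/

section Quantales

variable (Ω : Type w) [CommMonoid Ω] [CompleteLattice Ω]

/-- Integrality, cointegrality and non-triviality, the further properties which make a commutative
quantale *Lawvereian*. -/
structure IsLawvereian : Prop where
  integral : (1 : Ω) = ⊤
  cointegral : ∀ ε δ : Ω, ε * δ = ⊥ → ε = ⊥ ∨ δ = ⊥
  nontrivial : (1 : Ω) ≠ ⊥

variable {Ω}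

/-- The way-below relation `δ ≪ ε` of a complete lattice. -/
def WayBelow (δ ε : Ω) : Prop :=
  ∀ A : Set Ω, ε ≤ sSup A → ∃ A₀ : Set Ω, A₀ ⊆ A ∧ A₀.Finite ∧ δ ≤ sSup A₀

variable (Ω) in
/-- The quantale is continuous: each element is the join of the elements way below it. -/
def IsContinuousQuantale : Prop :=
  ∀ ε : Ω, ε = sSup {δ : Ω | WayBelow δ ε}

end Quantales

/-! ### Quantale-valued relations and abstract rewriting -/

/-- A quantale-valued relation from `A` to `B`; the order is pointwise. -/
abbrev QRel (Ω : Type w) (A B : Type*) := A → B → Ω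

namespace QRel

variable {Ω : Type w} [CommMonoid Ω] [CompleteLattice Ω] {A B C : Type*}

open Classical in
/-- The identity relation. -/
noncomputable def diag : QRel Ω A A := fun a b => if a = b then 1 else ⊥

/-- Composition `R ; S`. -/
def comp (R : QRel Ω A B) (S : QRel Ω B C) : QRel Ω A C := fun a c => ⨆ b, R a b * S b c

/-- The transpose of `R`. -/
def dual (R : QRel Ω A B) : QRel Ω B A := fun b a => R a b

/-- The `n`-th iterate of `R`. -/
noncomputable def iter (R : QRel Ω A A) : ℕ → QRel Ω A A
  | 0 => diag
  | n + 1 => comp R (iter R n)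

/-- The reflexive and transitive closure of `R`. -/
noncomputable def star (R : QRel Ω A A) : QRel Ω A A := ⨆ n, iter R n

/-- The diamond property. -/
def Diamond (R : QRel Ω A A) : Prop := comp (dual R) R ≤ comp R (dual R)

/-- `R` is confluent if its reflexive transitive closure has the diamond property. -/
def Confluent (R : QRel Ω A A) : Prop := Diamond (star R)

/-- `R` is locally confluent on the pair `(a, b)`: the join of all one-step peaks over `a` and `b`
is below the join of all valleys under `a` and `b`. -/
def LocallyConfluentOn (R : QRel Ω A A) (a b : A) : Prop :=
  comp (dual R) R a b ≤ comp (star R) (dual (star R)) a b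

/-- Local confluence. -/
def LocallyConfluent (R : QRel Ω A A) : Prop :=
  comp (dual R) R ≤ comp (star R) (dual (star R))

/-- The infinite sequence `s` is a reduction sequence: all its initial segments have nonzero
degree. -/
def IsInfiniteReduction (R : QRel Ω A A) (s : ℕ → A) : Prop :=
  ∀ n : ℕ, ∏ i ∈ Finset.range n, R (s i) (s (i + 1)) ≠ ⊥

/-- `R` is terminating (strongly normalising): there is no infinite reduction sequence. -/
def Terminating (R : QRel Ω A A) : Prop := ∀ s : ℕ → A, ¬ IsInfiniteReduction R s

end QRel

/-! ### Terms

A signature is a first-order language (its relation symbols play no role), and terms, substitution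
and renaming are Mathlib's `L.Term X`, `Term.subst` and `Term.relabel`. Positions are lists of
argument indices, counted from `0`. -/

namespace QTerm

variable {L : FirstOrder.Language.{u, v}} {X : Type*}

/-- The subterm of a term at a position, if the position exists. -/
def subtermAt : L.Term X → List ℕ → Option (L.Term X)
  | t, [] => some t
  | FirstOrder.Language.Term.var _, _ :: _ => none
  | FirstOrder.Language.Term.func (l := n) _ ts, i :: p =>
      if h : i < n then subtermAt (ts ⟨i, h⟩) p else none

/-- `replaceAt t p s` is `t[s]_p`, the term `t` with its subterm at the position `p` replaced by `s`
(only used where `p` is a position of `t`). -/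
def replaceAt : L.Term X → List ℕ → L.Term X → L.Term X
  | _, [], s => s
  | FirstOrder.Language.Term.var x, _ :: _, _ => FirstOrder.Language.Term.var x
  | FirstOrder.Language.Term.func f ts, i :: p, s =>
      FirstOrder.Language.Term.func f fun j => if (j : ℕ) = i then replaceAt (ts j) p s else ts j

/-- The set of variables of a term. -/
def vars (t : L.Term X) : Set X := {x | ∃ p, subtermAt t p = some (FirstOrder.Language.Term.var x)}

/-- A term is linear if no variable has more than one occurrence in it. -/
def IsLinear (t : L.Term X) : Prop :=
  ∀ (x : X) (p q : List ℕ), subtermAt t p = some (FirstOrder.Language.Term.var x) →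
    subtermAt t q = some (FirstOrder.Language.Term.var x) → p = q

/-- The term is not a variable, i.e. its root is a function symbol. -/
def IsFunc (t : L.Term X) : Prop := ∀ x : X, t ≠ FirstOrder.Language.Term.var x

/-- `σ` is a unifier of `a` and `b`. -/
def IsUnifier (σ : X → L.Term X) (a b : L.Term X) : Prop := a.subst σ = b.subst σ

/-- `σ` is a most general unifier of `a` and `b`: each unifier arises from `σ` by a further
substitution. -/
def IsMGU (σ : X → L.Term X) (a b : L.Term X) : Prop :=
  IsUnifier σ a b ∧
    ∀ τ : X → L.Term X, IsUnifier τ a b → ∃ ρ : X → L.Term X, ∀ x, τ x = (σ x).subst ρ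

end QTerm

/-! ### Quantale-valued term rewriting systems -/

/-- A quantale-valued term rewriting system: a ternary relation `a ↦^ε b` on terms, antitone in the
weight `ε`. -/
structure QTRS (L : FirstOrder.Language.{u, v}) (X : Type*) (Ω : Type w) [LE Ω] where
  Rule : L.Term X → Ω → L.Term X → Prop
  antitone : ∀ a b ε δ, δ ≤ ε → Rule a ε b → Rule a δ b

namespace QTRS

open QTerm

variable {L : FirstOrder.Language.{u, v}} {X : Type*} {Ω : Type w} [CommMonoid Ω] [CompleteLattice Ω]

/-- The ternary rewriting relation `ε ⊩ e → f` generated by the rules. In `rewrite`, the one-hole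
context `C[·]` is given by a term `e` and a position `p` of `e`. -/
inductive Step (S : QTRS L X Ω) : Ω → L.Term X → L.Term X → Prop
  | rewrite (a b : L.Term X) (ε : Ω) (h : S.Rule a ε b) (σ : X → L.Term X) (e : L.Term X)
      (p : List ℕ) (hp : subtermAt e p = some (a.subst σ)) :
      Step S ε e (replaceAt e p (b.subst σ))
  | weaken (ε δ : Ω) (e f : L.Term X) (h : Step S ε e f) (hle : δ ≤ ε) : Step S δ e f
  | join (A : Set Ω) (hfin : A.Finite) (hne : A.Nonempty) (e f : L.Term X)
      (h : ∀ ε ∈ A, Step S ε e f) : Step S (sSup A) e f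
  | archimedean (ε : Ω) (e f : L.Term X) (h : ∀ δ, WayBelow δ ε → Step S δ e f) : Step S ε e f

/-- The rewriting quantale-valued relation on terms induced by the system. -/
def rel (S : QTRS L X Ω) : QRel Ω (L.Term X) (L.Term X) := fun e f => sSup {ε | S.Step ε e f}

/-- The system is linear: both sides of each rule are linear terms. -/
def Linear (S : QTRS L X Ω) : Prop := ∀ a ε b, S.Rule a ε b → IsLinear a ∧ IsLinear b

/-- In each rule of nonzero weight, the variables of the right-hand side occur on the left-hand
side. -/
def VariableCondition (S : QTRS L X Ω) : Prop := ∀ a ε b, S.Rule a ε b → ε ≠ ⊥ → vars b ⊆ vars a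

/-- `c ↦^ε d` is a renaming of a rule. -/
def RenamedRule (S : QTRS L X Ω) (c : L.Term X) (ε : Ω) (d : L.Term X) : Prop :=
  ∃ (a b : L.Term X) (π : Equiv.Perm X), S.Rule a ε b ∧ c = a.relabel π ∧ d = b.relabel π

/-- The rules `c₁ ↦ d₁` and `c₂ ↦ d₂` are obtained one from the other by renaming variables. As the
rules are closed under lowering of the weight, weights are disregarded. -/
def AreVariants (c₁ d₁ c₂ d₂ : L.Term X) : Prop :=
  ∃ π : Equiv.Perm X, c₂ = c₁.relabel π ∧ d₂ = d₁.relabel π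

/-- The renamed rules `c₁ ↦^ε d₁` and `c₂ ↦^δ d₂`, without common variables, overlap at the
position `p`, where `s` is the subterm of `c₂` at `p`. -/
structure IsOverlap (S : QTRS L X Ω) (c₁ : L.Term X) (ε : Ω) (d₁ : L.Term X) (c₂ : L.Term X) (δ : Ω)
    (d₂ : L.Term X) (p : List ℕ) (s : L.Term X) : Prop where
  rule₁ : S.RenamedRule c₁ ε d₁
  rule₂ : S.RenamedRule c₂ δ d₂
  disjoint : Disjoint (vars c₁ ∪ vars d₁) (vars c₂ ∪ vars d₂)
  position : subtermAt c₂ p = some s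
  function_position : IsFunc s
  unifiable : ∃ σ : X → L.Term X, IsUnifier σ s c₁
  not_variants : p = [] → ¬ AreVariants c₁ d₁ c₂ d₂

/-- `(t₁, t₂)` is a critical pair of the system. -/
def IsCriticalPair (S : QTRS L X Ω) (t₁ t₂ : L.Term X) : Prop :=
  ∃ (c₁ : L.Term X) (ε : Ω) (d₁ c₂ : L.Term X) (δ : Ω) (d₂ : L.Term X) (p : List ℕ) (s : L.Term X)
    (σ : X → L.Term X), S.IsOverlap c₁ ε d₁ c₂ δ d₂ p s ∧ IsMGU σ s c₁ ∧
      t₁ = replaceAt (c₂.subst σ) p (d₁.subst σ) ∧ t₂ = d₂.subst σ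

/-- The system is locally confluent on all its critical pairs. -/
def LocallyConfluentOnCriticalPairs (S : QTRS L X Ω) : Prop :=
  ∀ t₁ t₂, S.IsCriticalPair t₁ t₂ → S.rel.LocallyConfluentOn t₁ t₂

end QTRS

/-! The tensor distributes over joins, and continuity keeps the closure rules of `Step` from raising
degrees. So a one-step peak is a join of products `ε * δ`, one for each pair of single contractions
of a common term, and each product has to be bounded by a valley. Contractions in different
arguments commute. If one redex lies inside the substitution of another, left-linearity keeps the
outer rule applicable and right-linearity leaves at most one copy of the inner redex, so each weight
is paid at most once. If the redexes overlap at a function symbol, the peak is an instance of a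
critical one, and substitution preserves valleys (`QRel.valley_map`); the overlap of a rule with its
own variant at the root is trivial by the variable condition. This is the critical pair lemma.

For confluence, termination forces the variable condition, and Newman's lemma survives because its
diagram uses every degree exactly once, so no idempotence is needed. Cointegrality makes the steps
of nonzero degree well-founded.

Without linearity, take `a ↦ b` of weight `ε` and `g(x) ↦ f(x, x)`. There are no critical pairs, and
the peak `g(b) ← g(a) → f(a, a)` has degree at least `ε`. Joining it requires both copies of `a` to
be contracted, so its valleys have degree at most `ε * ε`. The bound comes from the potential `ε ^
count t`. -/

namespace QRel

/-! ### Valleys, closures and Newman's lemma -/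

variable {Ω : Type w} [CommMonoid Ω] [CompleteLattice Ω] {A B : Type*}

theorem iter_le_star (R : QRel Ω A A) (n : ℕ) (a b : A) : iter R n a b ≤ star R a b :=
  le_iSup (iter R) n a b

theorem one_le_star_self (R : QRel Ω A A) (a : A) : 1 ≤ star R a a :=
  le_trans (by simp [iter, diag]) (iter_le_star R 0 a a)

/-- The join of the degrees of all valleys under `a` and `b`. -/
noncomputable def valley (R : QRel Ω A A) (a b : A) : Ω := comp (star R) (dual (star R)) a b

theorem le_valley (R : QRel Ω A A) (a b c : A) : star R a c * star R b c ≤ valley R a b :=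
  le_iSup (fun c => star R a c * star R b c) c

theorem valley_comm (R : QRel Ω A A) (a b : A) : valley R a b = valley R b a := by
  simp only [valley, comp, dual, mul_comm]

theorem prod_ne_bot (hΩ : IsLawvereian Ω) {ι : Type*} (s : Finset ι) (f : ι → Ω)
    (h : ∀ i ∈ s, f i ≠ ⊥) : ∏ i ∈ s, f i ≠ ⊥ :=
  Finset.prod_induction f (· ≠ ⊥)
    (fun a b ha hb hab => (hΩ.cointegral a b hab).elim ha hb) hΩ.nontrivial h

/-- By cointegrality a finite product of nonzero degrees is nonzero, so an infinite chain of nonzero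
steps would be an infinite reduction. -/
theorem Terminating.wellFounded (hΩ : IsLawvereian Ω) {R : QRel Ω A A} (h : Terminating R) :
    WellFounded fun b a => R a b ≠ ⊥ := by
  rw [wellFounded_iff_isEmpty_descending_chain]
  exact ⟨fun ⟨s, hs⟩ => h s fun n => prod_ne_bot hΩ _ _ fun i _ => hs i⟩

variable [IsQuantale Ω]

/-- Elimination of `star`: a weight function decreased by one step is decreased by many. -/
theorem iter_mul_le {R : QRel Ω A A} {x : A → Ω} (h : ∀ a b, R a b * x b ≤ x a) (n : ℕ) (a b : A) :
    iter R n a b * x b ≤ x a := by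
  classical
  induction n generalizing a with
  | zero =>
    simp only [iter, diag]
    split_ifs with hab
    · simp [hab]
    · simp
  | succ n ih =>
    simp only [iter, comp, Quantale.iSup_mul_distrib]
    refine iSup_le fun c => ?_
    rw [mul_assoc]
    exact (mul_le_mul_right (ih c) _).trans (h a c)

theorem star_mul_le {R : QRel Ω A A} {x : A → Ω} (h : ∀ a b, R a b * x b ≤ x a) (a b : A) :
    star R a b * x b ≤ x a := by
  simp only [star, iSup_apply, Quantale.iSup_mul_distrib]
  exact iSup_le fun n => iter_mul_le h n a b

theorem mul_star_le_star (R : QRel Ω A A) (a b c : A) : R a b * star R b c ≤ star R a c := by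
  simp only [star, iSup_apply, Quantale.mul_iSup_distrib]
  exact iSup_le fun n => (le_iSup (fun b => R a b * iter R n b c) b).trans
    (le_iSup (fun n => iter R n a c) (n + 1))

theorem le_star (R : QRel Ω A A) (a b : A) : R a b ≤ star R a b :=
  calc R a b = R a b * 1 := (mul_one _).symm
    _ ≤ R a b * star R b b := mul_le_mul_right (one_le_star_self R b) _
    _ ≤ star R a b := mul_star_le_star R a b b

theorem star_trans (R : QRel Ω A A) (a b c : A) : star R a b * star R b c ≤ star R a c :=
  star_mul_le (x := fun b => star R b c) (fun a b => mul_star_le_star R a b c) a b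

theorem star_map {R : QRel Ω A A} {S : QRel Ω B B} {F : A → B}
    (h : ∀ a b, R a b ≤ S (F a) (F b)) (a b : A) : star R a b ≤ star S (F a) (F b) :=
  calc star R a b = star R a b * 1 := (mul_one _).symm
    _ ≤ star R a b * star S (F b) (F b) := mul_le_mul_right (one_le_star_self S _) _
    _ ≤ star S (F a) (F b) := star_mul_le (x := fun c => star S (F c) (F b))
        (fun a c => (mul_le_mul_left (h a c) _).trans (mul_star_le_star S _ _ _)) a b

/-- Applied with `F` a substitution instance or a context, this transports a valley found for a
critical pair or for an argument to the surrounding terms. -/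
theorem valley_map {R : QRel Ω A A} {S : QRel Ω B B} {F : A → B}
    (h : ∀ a b, R a b ≤ S (F a) (F b)) (a b : A) : valley R a b ≤ valley S (F a) (F b) :=
  iSup_le fun c => (mul_le_mul' (star_map h a c) (star_map h b c)).trans (le_valley S _ _ _)

theorem star_mul_valley_le (R : QRel Ω A A) (a b c : A) :
    star R a b * valley R b c ≤ valley R a c := by
  simp only [valley, comp, Quantale.mul_iSup_distrib]
  refine iSup_le fun d => ?_
  rw [← mul_assoc]
  exact (mul_le_mul_left (star_trans R a b d) _).trans (le_valley R a c d)

theorem star_le_valley (R : QRel Ω A A) (a b : A) : star R a b ≤ valley R a b :=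
  calc star R a b = star R a b * 1 := (mul_one _).symm
    _ ≤ star R a b * star R b b := mul_le_mul_right (one_le_star_self R b) _
    _ ≤ valley R a b := le_valley R a b b

theorem one_le_valley_self (R : QRel Ω A A) (a : A) : 1 ≤ valley R a a :=
  (one_le_star_self R a).trans (star_le_valley R a a)

theorem locallyConfluent_of_confluent {R : QRel Ω A A} (h : Confluent R) : LocallyConfluent R :=
  fun a b => (iSup_mono fun c => mul_le_mul' (le_star R c a) (le_star R c b)).trans (h a b)

/-- Newman's lemma for quantale-valued relations. -/
theorem confluent_of_terminating (hΩ : IsLawvereian Ω) {R : QRel Ω A A} (ht : Terminating R)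
    (hl : LocallyConfluent R) : Confluent R := by
  have key : ∀ a b c, star R a b * star R a c ≤ valley R b c := by
    intro a
    induction a using (ht.wellFounded hΩ).induction with
    | _ a ih =>
    intro b c
    simp only [star, iSup_apply, Quantale.iSup_mul_distrib, Quantale.mul_iSup_distrib]
    refine iSup_le fun m => iSup_le fun n => ?_
    have refl_case : ∀ b c, iter R 0 a b * star R a c ≤ valley R b c := by
      classical
      intro b c
      simp only [iter, diag]
      split_ifs with hab
      · rw [← hab, one_mul]
        exact star_le_valley R a c
      · simp
    rcases n with _ | n
    · exact (mul_le_mul_right (iter_le_star R m a c) _).trans (refl_case b c)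
    rcases m with _ | m
    · rw [mul_comm, valley_comm]
      exact (mul_le_mul_right (iter_le_star R _ a b) _).trans (refl_case c b)
    simp only [iter, comp, Quantale.iSup_mul_distrib, Quantale.mul_iSup_distrib]
    refine iSup_le fun c' => iSup_le fun b' => ?_
    -- First steps of degree `⊥` contribute nothing; the others make `b'` and `c'` smaller in the
    -- well-founded order.
    by_cases hb : R a b' = ⊥
    · simp [hb]
    by_cases hc : R a c' = ⊥
    · simp [hc]
    have hpeak : R a b' * R a c' ≤ valley R b' c' :=
      (le_iSup (fun a => R a b' * R a c') a).trans (hl b' c')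
    calc R a b' * iter R n b' b * (R a c' * iter R m c' c)
        = iter R n b' b * iter R m c' c * (R a b' * R a c') := by ac_rfl
      _ ≤ star R b' b * star R c' c * valley R b' c' :=
          mul_le_mul' (mul_le_mul' (iter_le_star R n _ _) (iter_le_star R m _ _)) hpeak
      _ ≤ valley R b c := by
          -- Let `d` be the bottom of the local valley under `b'` and `c'`. The induction hypothesis
          -- at `b'` joins `d` and `b`; prefixing `c' → d` gives a valley under `c'` and `b`, with
          -- bottom `e`, and the hypothesis at `c'` joins `e` and `c`.
          simp only [valley, comp, Quantale.mul_iSup_distrib]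
          refine iSup_le fun d => ?_
          calc star R b' b * star R c' c * (star R b' d * dual (star R) d c')
              = star R c' c * (star R c' d * (star R b' d * star R b' b)) := by
                simp only [dual]; ac_rfl
            _ ≤ star R c' c * (star R c' d * valley R d b) :=
                mul_le_mul_right (mul_le_mul_right (ih b' hb d b) _) _
            _ ≤ star R c' c * valley R c' b := mul_le_mul_right (star_mul_valley_le R c' d b) _
            _ ≤ valley R b c := by
                rw [valley_comm R c' b, valley_comm R b c]
                simp only [valley, comp, Quantale.mul_iSup_distrib]
                refine iSup_le fun e => ?_
                calc star R c' c * (star R b e * dual (star R) e c')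
                    = star R b e * (star R c' e * star R c' c) := by simp only [dual]; ac_rfl
                  _ ≤ star R b e * valley R e c := mul_le_mul_right (ih c' hc e c) _
                  _ ≤ valley R b c := star_mul_valley_le R b e c
                  _ = valley R c b := valley_comm R b c
  exact fun b c => iSup_le fun a => key a b c

end QRel

/-! ### Positions, substitutions and unification of linear terms -/

namespace QTerm

open FirstOrder.Language FirstOrder.Language.Term

variable {L : FirstOrder.Language.{u, v}} {X : Type*}

@[simp] theorem subtermAt_nil (t : L.Term X) : subtermAt t [] = some t := by
  cases t <;> rfl

@[simp] theorem subtermAt_var_cons (x : X) (i : ℕ) (p : List ℕ) :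
    subtermAt (var x : L.Term X) (i :: p) = none := rfl

@[simp] theorem subtermAt_func_cons {n : ℕ} (f : L.Functions n) (ts : Fin n → L.Term X)
    (i : Fin n) (p : List ℕ) : subtermAt (func f ts) (i :: p) = subtermAt (ts i) p := by
  simp [subtermAt]

theorem subtermAt_func_cons_eq_some {n : ℕ} {f : L.Functions n} {ts : Fin n → L.Term X}
    {k : ℕ} {p : List ℕ} {s : L.Term X} :
    subtermAt (func f ts) (k :: p) = some s ↔ ∃ i : Fin n, k = i ∧ subtermAt (ts i) p = some s := by
  simp only [subtermAt]
  split_ifs with h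
  · constructor
    · exact fun hs => ⟨⟨k, h⟩, rfl, hs⟩
    · rintro ⟨i, rfl, hs⟩
      exact hs
  · simp only [false_iff]
    rintro ⟨i, rfl, -⟩
    exact h i.2

@[simp] theorem replaceAt_nil (t s : L.Term X) : replaceAt t [] s = s := by
  cases t <;> rfl

theorem replaceAt_func_cons {n : ℕ} (f : L.Functions n) (ts : Fin n → L.Term X)
    (i : Fin n) (p : List ℕ) (s : L.Term X) :
    replaceAt (func f ts) (i :: p) s
      = func f (Function.update ts i (replaceAt (ts i) p s)) := by
  simp only [replaceAt]
  congr 1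
  funext j
  by_cases h : j = i
  · subst h; simp
  · simp [h, Fin.val_inj]

theorem subst_var (x : X) (σ : X → L.Term X) : (var x : L.Term X).subst σ = σ x := rfl

theorem subst_func {n : ℕ} (f : L.Functions n) (ts : Fin n → L.Term X) (σ : X → L.Term X) :
    (func f ts).subst σ = func f fun i => (ts i).subst σ := rfl

theorem func_update_subst {n : ℕ} (f : L.Functions n) (ts : Fin n → L.Term X) (i : Fin n)
    (t : L.Term X) (σ : X → L.Term X) :
    (func f (Function.update ts i t)).subst σ
      = func f (Function.update (fun j => (ts j).subst σ) i (t.subst σ)) := by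
  rw [subst_func]
  congr 1
  funext j
  by_cases h : j = i
  · subst h; simp
  · simp [h]

theorem subst_subst (t : L.Term X) (σ τ : X → L.Term X) :
    (t.subst σ).subst τ = t.subst fun x => (σ x).subst τ := by
  induction t with
  | var x => rfl
  | func f ts ih => simp only [subst_func, ih]

theorem relabel_subst (t : L.Term X) (g : X → X) (σ : X → L.Term X) :
    (t.relabel g).subst σ = t.subst (σ ∘ g) := by
  induction t with
  | var x => rfl
  | func f ts ih => simp only [relabel, subst_func, ih]

theorem subst_var_eq_self (t : L.Term X) : t.subst var = t := by
  induction t with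
  | var x => rfl
  | func f ts ih => simp only [subst_func, ih]

theorem subtermAt_subst {t s : L.Term X} {p : List ℕ} (h : subtermAt t p = some s)
    (σ : X → L.Term X) : subtermAt (t.subst σ) p = some (s.subst σ) := by
  induction p generalizing t with
  | nil => simp only [subtermAt_nil, Option.some.injEq] at h ⊢; rw [h]
  | cons k p ih =>
    cases t with
    | var x => simp at h
    | func f ts =>
      obtain ⟨i, rfl, hi⟩ := subtermAt_func_cons_eq_some.1 h
      exact subtermAt_func_cons_eq_some.2 ⟨i, rfl, ih hi⟩

theorem replaceAt_subst {t s : L.Term X} {p : List ℕ} (h : subtermAt t p = some s)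
    (u : L.Term X) (σ : X → L.Term X) :
    (replaceAt t p u).subst σ = replaceAt (t.subst σ) p (u.subst σ) := by
  induction p generalizing t with
  | nil => simp
  | cons k p ih =>
    cases t with
    | var x => simp at h
    | func f ts =>
      obtain ⟨i, rfl, hi⟩ := subtermAt_func_cons_eq_some.1 h
      rw [replaceAt_func_cons, func_update_subst, ih hi, subst_func, replaceAt_func_cons]

theorem replaceAt_self {t s : L.Term X} {p : List ℕ} (h : subtermAt t p = some s) :
    replaceAt t p s = t := by
  induction p generalizing t with
  | nil => simpa using h.symm
  | cons k p ih =>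
    cases t with
    | var x => simp at h
    | func f ts =>
      obtain ⟨i, rfl, hi⟩ := subtermAt_func_cons_eq_some.1 h
      rw [replaceAt_func_cons, ih hi, Function.update_eq_self]

@[simp] theorem vars_var (x : X) : vars (var x : L.Term X) = {x} := by
  ext y
  simp only [vars, Set.mem_ofPred_eq, Set.mem_singleton_iff]
  constructor
  · rintro ⟨_ | ⟨i, p⟩, hp⟩
    · simpa using hp.symm
    · simp at hp
  · rintro rfl
    exact ⟨[], by simp⟩

@[simp] theorem vars_func {n : ℕ} (f : L.Functions n) (ts : Fin n → L.Term X) :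
    vars (func f ts) = ⋃ i, vars (ts i) := by
  ext y
  simp only [vars, Set.mem_ofPred_eq, Set.mem_iUnion]
  constructor
  · rintro ⟨_ | ⟨k, p⟩, hp⟩
    · simp at hp
    · obtain ⟨i, rfl, hi⟩ := subtermAt_func_cons_eq_some.1 hp
      exact ⟨i, p, hi⟩
  · rintro ⟨i, p, hp⟩
    exact ⟨i :: p, by simpa using hp⟩

theorem finite_vars (t : L.Term X) : (vars t).Finite := by
  induction t with
  | var x => simp
  | func f ts ih => rw [vars_func]; exact Set.finite_iUnion ih

theorem vars_relabel (t : L.Term X) (g : X → X) : vars (t.relabel g) = g '' vars t := by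
  induction t with
  | var x => simp [relabel]
  | func f ts ih => simp only [relabel, vars_func, ih, Set.image_iUnion]

theorem vars_subset_of_subtermAt {t s : L.Term X} {p : List ℕ} (h : subtermAt t p = some s) :
    vars s ⊆ vars t := by
  induction p generalizing t with
  | nil => simp only [subtermAt_nil, Option.some.injEq] at h; rw [h]
  | cons k p ih =>
    cases t with
    | var x => simp at h
    | func f ts =>
      obtain ⟨i, rfl, hi⟩ := subtermAt_func_cons_eq_some.1 h
      rw [vars_func]
      exact (ih hi).trans (Set.subset_iUnion (fun i => vars (ts i)) i)

theorem subst_congr {t : L.Term X} {σ τ : X → L.Term X} (h : ∀ x ∈ vars t, σ x = τ x) :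
    t.subst σ = t.subst τ := by
  induction t with
  | var x => exact h x (by simp)
  | func f ts ih =>
    simp only [subst_func]
    congr 1
    funext i
    exact ih i fun x hx => h x (by rw [vars_func]; exact Set.mem_iUnion_of_mem i hx)

theorem eq_of_subst_eq {t : L.Term X} {σ τ : X → L.Term X} (h : t.subst σ = t.subst τ) :
    ∀ x ∈ vars t, σ x = τ x := by
  induction t with
  | var x => simpa [subst_var] using h
  | func f ts ih =>
    intro x hx
    rw [vars_func] at hx
    obtain ⟨i, hi⟩ := Set.mem_iUnion.1 hx
    simp only [subst_func, func.injEq, heq_eq_eq, true_and] at h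
    exact ih i (congrFun h i) x hi

theorem IsLinear.arg {n : ℕ} {f : L.Functions n} {ts : Fin n → L.Term X}
    (h : IsLinear (func f ts)) (i : Fin n) : IsLinear (ts i) := fun x p q hp hq =>
  (List.cons.inj (h x (i :: p) (i :: q) (by simpa using hp) (by simpa using hq))).2

theorem IsLinear.eq_of_mem_vars {n : ℕ} {f : L.Functions n} {ts : Fin n → L.Term X}
    (h : IsLinear (func f ts)) {i j : Fin n} {x : X} (hi : x ∈ vars (ts i))
    (hj : x ∈ vars (ts j)) : i = j := by
  obtain ⟨p, hp⟩ := hi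
  obtain ⟨q, hq⟩ := hj
  exact Fin.ext (List.cons.inj (h x (i :: p) (j :: q) (by simpa using hp) (by simpa using hq))).1

theorem IsLinear.subterm {t s : L.Term X} {p : List ℕ} (ht : IsLinear t)
    (h : subtermAt t p = some s) : IsLinear s := by
  induction p generalizing t with
  | nil => simp only [subtermAt_nil, Option.some.injEq] at h; rwa [← h]
  | cons k p ih =>
    cases t with
    | var x => simp at h
    | func f ts =>
      obtain ⟨i, rfl, hi⟩ := subtermAt_func_cons_eq_some.1 h
      exact ih (ht.arg i) hi

theorem subtermAt_relabel_eq_var {t : L.Term X} {g : X → X} {p : List ℕ} {y : X}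
    (h : subtermAt (t.relabel g) p = some (var y)) :
    ∃ x, g x = y ∧ subtermAt t p = some (var x) := by
  induction p generalizing t with
  | nil =>
    cases t with
    | var x => exact ⟨x, by simpa [relabel] using h, by simp⟩
    | func f ts => simp [relabel] at h
  | cons k p ih =>
    cases t with
    | var x => simp [relabel] at h
    | func f ts =>
      obtain ⟨i, rfl, hi⟩ := subtermAt_func_cons_eq_some.1 h
      simpa using ih hi

theorem IsLinear.relabel {t : L.Term X} (ht : IsLinear t) {g : X → X} (hg : g.Injective) :
    IsLinear (t.relabel g) := by
  intro y p q hp hq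
  obtain ⟨x, hx, hp⟩ := subtermAt_relabel_eq_var hp
  obtain ⟨z, hz, hq⟩ := subtermAt_relabel_eq_var hq
  obtain rfl := hg (hx.trans hz.symm)
  exact ht x p q hp hq

/-- Two linear terms without common variables which have a unifier have a most general one. -/
theorem exists_isMGU {s t : L.Term X} (hs : IsLinear s) (ht : IsLinear t)
    (hd : Disjoint (vars s) (vars t)) {τ : X → L.Term X} (hτ : IsUnifier τ s t) :
    ∃ σ : X → L.Term X, IsUnifier σ s t ∧
      ∀ τ : X → L.Term X, IsUnifier τ s t → ∀ x, τ x = (σ x).subst τ := by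
  -- Every unifier `τ` factors through `σ` by `τ` itself. As this factor does not depend on the
  -- argument, the unifiers found for the arguments can be glued.
  classical
  induction s generalizing t with
  | var x =>
    have hx : x ∉ vars t := by simpa using hd
    refine ⟨Function.update var x t, ?_, fun τ hτ y => ?_⟩
    · rw [IsUnifier, subst_var, Function.update_self]
      refine (subst_var_eq_self t).symm.trans (subst_congr fun y hy => ?_)
      rw [Function.update_of_ne (by rintro rfl; exact hx hy)]
    · by_cases h : y = x
      · subst h; simpa [IsUnifier, subst_var] using hτ
      · simp [h]
  | @func n f ss ih =>
    cases t with
    | var x =>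
      have hx : x ∉ vars (func f ss) := by simpa using hd.symm
      refine ⟨Function.update var x (func f ss), ?_, fun τ hτ y => ?_⟩
      · rw [IsUnifier, subst_var, Function.update_self]
        refine ((subst_var_eq_self _).symm.trans (subst_congr fun y hy => ?_)).symm
        rw [Function.update_of_ne (by rintro rfl; exact hx hy)]
      · by_cases h : y = x
        · subst h; simpa [IsUnifier, subst_var] using Eq.symm hτ
        · simp [h]
    | @func m g ts =>
      obtain rfl : n = m := by
        have := hτ; simp only [IsUnifier, subst_func, func.injEq] at this; exact this.1
      obtain rfl : f = g := by
        have := hτ; simp only [IsUnifier, subst_func, func.injEq] at this; exact eq_of_heq this.2.1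
      have args : ∀ τ : X → L.Term X,
          IsUnifier τ (func f ss) (func f ts) ↔ ∀ i, IsUnifier τ (ss i) (ts i) := by
        intro τ
        simp only [IsUnifier, subst_func, func.injEq, heq_eq_eq, true_and]
        exact funext_iff
      have hd' : ∀ i j, Disjoint (vars (ss i)) (vars (ts j)) := fun i j => by
        rw [vars_func, vars_func] at hd
        exact hd.mono (Set.subset_iUnion (fun i => vars (ss i)) i)
          (Set.subset_iUnion (fun i => vars (ts i)) j)
      choose σ hσ hgen using fun i =>
        ih i (hs.arg i) (ht.arg i) (hd' i i) ((args τ).1 hτ i)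
      have huniq : ∀ x i j, x ∈ vars (ss i) ∪ vars (ts i) → x ∈ vars (ss j) ∪ vars (ts j) →
          i = j := by
        rintro x i j (hi | hi) (hj | hj)
        · exact hs.eq_of_mem_vars hi hj
        · exact ((Set.disjoint_left.1 (hd' i j) hi) hj).elim
        · exact ((Set.disjoint_left.1 (hd' j i) hj) hi).elim
        · exact ht.eq_of_mem_vars hi hj
      -- By linearity and disjointness each variable belongs to at most one pair of arguments, so
      -- the unifiers `σ i` never conflict.
      let ρ : X → L.Term X := fun x =>
        if h : ∃ i, x ∈ vars (ss i) ∪ vars (ts i) then σ h.choose x else var x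
      have hρ : ∀ i, ∀ x ∈ vars (ss i) ∪ vars (ts i), ρ x = σ i x := by
        intro i x hx
        have h : ∃ i, x ∈ vars (ss i) ∪ vars (ts i) := ⟨i, hx⟩
        simp only [ρ, dif_pos h, huniq x _ i h.choose_spec hx]
      refine ⟨ρ, (args ρ).2 fun i => ?_, fun τ hτ x => ?_⟩
      · rw [IsUnifier, subst_congr fun x hx => hρ i x (Or.inl hx),
          subst_congr fun x hx => hρ i x (Or.inr hx)]
        exact hσ i
      · by_cases h : ∃ i, x ∈ vars (ss i) ∪ vars (ts i)
        · obtain ⟨i, hi⟩ := h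
          rw [hρ i x hi]
          exact hgen i τ ((args τ).1 hτ i) x
        · simp only [ρ, dif_neg h, subst_var]

end QTerm

/-- A finite set of a countably infinite type can be moved off another one by a permutation. -/
theorem exists_perm_disjoint {X : Type*} [Countable X] [Infinite X] {s t : Set X}
    (hs : s.Finite) (ht : t.Finite) : ∃ π : Equiv.Perm X, Disjoint (π '' s) t := by
  obtain ⟨e⟩ : Nonempty (X ≃ ℤ) := nonempty_equiv_of_countable
  obtain ⟨a, ha⟩ := (hs.image e).bddBelow
  obtain ⟨b, hb⟩ := (ht.image e).bddAbove
  -- Inside `ℤ`, shift by `b - a + 1`: the lower bound `a` of `s` moves just beyond the upper bound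
  -- `b` of `t`.
  refine ⟨(e.trans (Equiv.addRight (b - a + 1))).trans e.symm, Set.disjoint_left.2 ?_⟩
  rintro _ ⟨x, hx, rfl⟩ hy
  have h1 := ha ⟨x, hx, rfl⟩
  have h2 := hb ⟨_, hy, rfl⟩
  simp at h2
  omega

/-! ### Single contractions and the rewriting relation -/

namespace QTRS

open QTerm QRel FirstOrder.Language FirstOrder.Language.Term

variable {L : FirstOrder.Language.{u, v}} {X : Type*} {Ω : Type w} [CompleteLattice Ω]

/-- Contraction of a single redex by a rule of weight `ε`. -/
inductive Red (S : QTRS L X Ω) (ε : Ω) : L.Term X → L.Term X → Prop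
  | root (a b : L.Term X) (h : S.Rule a ε b) (σ : X → L.Term X) : Red S ε (a.subst σ) (b.subst σ)
  | arg {n : ℕ} (f : L.Functions n) (ts : Fin n → L.Term X) (i : Fin n) (t : L.Term X)
      (h : Red S ε (ts i) t) : Red S ε (func f ts) (func f (Function.update ts i t))

variable {S : QTRS L X Ω} {ε δ : Ω}

theorem Red.replaceAt {e t u : L.Term X} {p : List ℕ} (hp : subtermAt e p = some t)
    (h : S.Red ε t u) : S.Red ε e (replaceAt e p u) := by
  induction p generalizing e with
  | nil => simp only [subtermAt_nil, Option.some.injEq] at hp; simpa [hp] using h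
  | cons k p ih =>
    cases e with
    | var x => simp at hp
    | func f ts =>
      obtain ⟨i, rfl, hi⟩ := subtermAt_func_cons_eq_some.1 hp
      rw [replaceAt_func_cons]
      exact Red.arg f ts i _ (ih hi)

theorem Red.exists_position {e f : L.Term X} (h : S.Red ε e f) :
    ∃ (a b : L.Term X) (σ : X → L.Term X) (p : List ℕ), S.Rule a ε b ∧
      subtermAt e p = some (a.subst σ) ∧ f = QTerm.replaceAt e p (b.subst σ) := by
  induction h with
  | root a b h σ => exact ⟨a, b, σ, [], h, by simp, by simp⟩
  | arg f ts i t h ih =>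
    obtain ⟨a, b, σ, p, hr, hp, rfl⟩ := ih
    exact ⟨a, b, σ, i :: p, hr, by simpa using hp, by rw [replaceAt_func_cons]⟩

theorem Red.subst {e f : L.Term X} (h : S.Red ε e f) (ρ : X → L.Term X) :
    S.Red ε (e.subst ρ) (f.subst ρ) := by
  induction h with
  | root a b h σ => rw [subst_subst, subst_subst]; exact Red.root a b h _
  | arg f ts i t h ih => rw [func_update_subst]; exact Red.arg f _ i _ ih

/-- An upper bound of the contraction weights survives weakening and finite joins, and continuity is
exactly what the archimedean rule requires. -/
theorem step_le_sSup_red (hcont : IsContinuousQuantale Ω) {e f : L.Term X} (h : S.Step ε e f) :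
    ε ≤ sSup {ε | S.Red ε e f} := by
  induction h with
  | rewrite a b ε h σ e p hp => exact le_sSup (Red.replaceAt hp (Red.root a b h σ))
  | weaken ε δ e f _ hle ih => exact hle.trans ih
  | join A _ _ e f _ ih => exact sSup_le ih
  | archimedean ε e f _ ih => rw [hcont ε]; exact sSup_le ih

theorem rel_eq (hcont : IsContinuousQuantale Ω) (e f : L.Term X) :
    S.rel e f = sSup {ε | S.Red ε e f} := by
  refine le_antisymm (sSup_le fun ε h => step_le_sSup_red hcont h) (sSup_le_sSup fun ε h => ?_)
  obtain ⟨a, b, σ, p, hr, hp, rfl⟩ := Red.exists_position h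
  exact Step.rewrite a b ε hr σ e p hp

theorem Red.le_rel {e f : L.Term X} (h : S.Red ε e f) : ε ≤ S.rel e f := by
  obtain ⟨a, b, σ, p, hr, hp, rfl⟩ := h.exists_position
  exact le_sSup (Step.rewrite a b ε hr σ e p hp)

theorem rel_subst (hcont : IsContinuousQuantale Ω) (ρ : X → L.Term X) (e f : L.Term X) :
    S.rel e f ≤ S.rel (e.subst ρ) (f.subst ρ) := by
  rw [rel_eq hcont]
  exact sSup_le fun ε h => (Red.subst h ρ).le_rel

theorem rel_arg (hcont : IsContinuousQuantale Ω) {n : ℕ} (f : L.Functions n)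
    (ts : Fin n → L.Term X) (i : Fin n) (t u : L.Term X) :
    S.rel t u ≤ S.rel (func f (Function.update ts i t)) (func f (Function.update ts i u)) := by
  rw [rel_eq hcont]
  refine sSup_le fun ε h => ?_
  have := Red.arg (S := S) (ε := ε) f (Function.update ts i t) i u (by simpa using h)
  rw [Function.update_idem] at this
  exact this.le_rel

theorem rel_replaceAt (hcont : IsContinuousQuantale Ω) {e s : L.Term X} {p : List ℕ}
    (hp : subtermAt e p = some s) (t u : L.Term X) :
    S.rel t u ≤ S.rel (replaceAt e p t) (replaceAt e p u) := by
  induction p generalizing e with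
  | nil => simp
  | cons k p ih =>
    cases e with
    | var x => simp at hp
    | func f ts =>
      obtain ⟨i, rfl, hi⟩ := subtermAt_func_cons_eq_some.1 hp
      rw [replaceAt_func_cons, replaceAt_func_cons]
      exact (ih hi).trans (rel_arg hcont f ts i _ _)

/-- A redex in an instance of a linear term lies inside the substitution or at a function
symbol. -/
theorem Red.of_subst [DecidableEq X] {t g : L.Term X} {σ : X → L.Term X} (ht : IsLinear t)
    (h : S.Red ε (t.subst σ) g) :
    (∃ x ∈ vars t, ∃ u, S.Red ε (σ x) u ∧ g = t.subst (Function.update σ x u)) ∨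
    ∃ (p : List ℕ) (s a b : L.Term X) (τ : X → L.Term X), subtermAt t p = some s ∧ IsFunc s ∧
      S.Rule a ε b ∧ s.subst σ = a.subst τ ∧ g = QTerm.replaceAt (t.subst σ) p (b.subst τ) := by
  induction t generalizing g with
  | var x => exact Or.inl ⟨x, by simp, g, h, by simp⟩
  | func f ts ih =>
    generalize he : (func f ts).subst σ = e at h
    cases h with
    | root a b hr τ =>
      exact Or.inr ⟨[], func f ts, a, b, τ, by simp, fun x => by simp, hr, he, by simp⟩
    | @arg m f' ts' i u hu =>
      rw [subst_func] at he
      injection he with h1 h2 h3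
      subst h1
      obtain rfl := eq_of_heq h2
      obtain rfl := eq_of_heq h3
      rcases ih i (ht.arg i) hu with ⟨x, hx, w, hw, rfl⟩ | ⟨p, s, a, b, τ, hp, hs, hr, hst, rfl⟩
      · refine Or.inl ⟨x, ?_, w, hw, ?_⟩
        · rw [vars_func]; exact Set.mem_iUnion_of_mem i hx
        · rw [subst_func]
          congr 1
          funext j
          by_cases hj : j = i
          · subst hj; simp
          -- By linearity `x` occurs in no other argument, so updating it there changes nothing.
          · rw [Function.update_of_ne hj]
            refine subst_congr fun y hy => ?_
            rw [Function.update_of_ne]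
            rintro rfl
            exact hj (ht.eq_of_mem_vars hy hx)
      · refine Or.inr ⟨i :: p, s, a, b, τ, by simpa using hp, hs, hr, hst, ?_⟩
        exact (replaceAt_func_cons f _ i p _).symm

/-- A step inside the substitution of a linear term is at most one step of the instance. -/
theorem Red.subst_update [DecidableEq X] {t : L.Term X} {σ : X → L.Term X} {x : X} {u : L.Term X}
    (ht : IsLinear t) (h : S.Red ε (σ x) u) :
    t.subst (Function.update σ x u) = t.subst σ ∨
      S.Red ε (t.subst σ) (t.subst (Function.update σ x u)) := by
  by_cases hx : x ∈ vars t
  · obtain ⟨p, hp⟩ := hx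
    right
    suffices t.subst (Function.update σ x u) = QTerm.replaceAt (t.subst σ) p u by
      rw [this]; exact h.replaceAt (subtermAt_subst hp σ)
    induction p generalizing t with
    | nil =>
      simp only [subtermAt_nil, Option.some.injEq] at hp
      simp [hp]
    | cons k p ih =>
      cases t with
      | var y => simp at hp
      | func f ts =>
        obtain ⟨i, rfl, hi⟩ := subtermAt_func_cons_eq_some.1 hp
        rw [subst_func, subst_func, replaceAt_func_cons, ← ih (ht.arg i) hi]
        congr 1
        funext j
        by_cases hj : j = i
        · subst hj; simp
        · rw [Function.update_of_ne hj]
          refine subst_congr fun y hy => ?_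
          rw [Function.update_of_ne]
          rintro rfl
          exact hj (ht.eq_of_mem_vars hy ⟨p, hi⟩)
  · refine Or.inl (subst_congr fun y hy => ?_)
    rw [Function.update_of_ne]
    rintro rfl
    exact hx hy

variable [CommMonoid Ω]

/-- Substituting the left-hand side `a` for an extra variable of `b` makes `a` rewrite to a term `c`
containing `a` at `p`. Nesting this context gives an infinite reduction `a → C[a] → C[C[a]] → ⋯` all
of whose steps have degree at least `ε`. -/
theorem variableCondition_of_terminating (hΩ : IsLawvereian Ω) (hcont : IsContinuousQuantale Ω)
    (ht : S.rel.Terminating) : S.VariableCondition := by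
  classical
  intro a ε b h hε x hx
  by_contra hxa
  obtain ⟨p, hp⟩ := hx
  have ha : a.subst (Function.update var x a) = a :=
    (subst_congr fun y hy =>
      Function.update_of_ne (ne_of_mem_of_not_mem hy hxa) _ _).trans
      (subst_var_eq_self a)
  have hp' := subtermAt_subst hp (Function.update var x a)
  rw [subst_var, Function.update_self] at hp'
  have hstep := (Red.root a b h (Function.update var x a)).le_rel
  rw [ha] at hstep
  generalize b.subst (Function.update var x a) = c at hp' hstep
  let F : L.Term X → L.Term X := replaceAt c p
  have hF : F a = c := replaceAt_self hp'
  have hrel : ∀ n, ε ≤ S.rel (F^[n] a) (F^[n + 1] a) := by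
    intro n
    induction n with
    | zero => simpa [hF] using hstep
    | succ n ih =>
      rw [Function.iterate_succ_apply' F n, Function.iterate_succ_apply' F (n + 1)]
      exact ih.trans (rel_replaceAt hcont hp' _ _)
  exact ht (fun n => F^[n] a) fun n => prod_ne_bot hΩ _ _ fun i _ h0 =>
    hε (le_bot_iff.1 (h0 ▸ hrel i))

variable [IsQuantale Ω]

/-! ### The critical pair lemma -/

theorem mul_le_valley {e₁ e₂ d : L.Term X} {x y : Ω} (h₁ : x ≤ S.rel.star e₁ d)
    (h₂ : y ≤ S.rel.star e₂ d) : x * y ≤ S.rel.valley e₁ e₂ :=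
  (mul_le_mul' h₁ h₂).trans (le_valley _ _ _ _)

/-- With the rules renamed apart, the two matching substitutions merge into one unifier, which
factors through a most general one. The peak is thus an instance of a critical peak, unless the
rules are variants overlapping at the root. -/
theorem overlap_le_valley [Countable X] [Infinite X] (hΩ : IsLawvereian Ω)
    (hcont : IsContinuousQuantale Ω) (hlin : S.Linear) (hvar : S.VariableCondition)
    (hcp : S.LocallyConfluentOnCriticalPairs) {a₁ b₁ a₂ b₂ s : L.Term X} (h₁ : S.Rule a₁ ε b₁)
    (h₂ : S.Rule a₂ δ b₂) {p : List ℕ} (hp : subtermAt a₂ p = some s) (hs : IsFunc s)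
    {σ₁ σ₂ : X → L.Term X} (hσ : s.subst σ₂ = a₁.subst σ₁) :
    ε * δ ≤ S.rel.valley (replaceAt (a₂.subst σ₂) p (b₁.subst σ₁)) (b₂.subst σ₂) := by
  classical
  by_cases hε : ε = ⊥
  · simp [hε]
  obtain ⟨π, hπ⟩ := exists_perm_disjoint ((finite_vars a₁).union (finite_vars b₁))
    ((finite_vars a₂).union (finite_vars b₂))
  rw [Set.image_union, ← vars_relabel, ← vars_relabel] at hπ
  -- Disjointness of variables lets `τ` act as `σ₂` on the second rule and as `σ₁`, through the
  -- renaming, on the first.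
  let τ : X → L.Term X := fun x =>
    if x ∈ vars a₂ ∪ vars b₂ then σ₂ x else σ₁ (π.symm x)
  have hτ₂ : ∀ t : L.Term X, vars t ⊆ vars a₂ ∪ vars b₂ → t.subst τ = t.subst σ₂ :=
    fun t ht => subst_congr fun x hx => if_pos (ht hx)
  have hτ₁ : ∀ t : L.Term X, vars (t.relabel π) ⊆ vars (a₁.relabel π) ∪ vars (b₁.relabel π) →
      (t.relabel π).subst τ = t.subst σ₁ := fun t ht => by
    rw [relabel_subst]
    refine subst_congr fun x hx => ?_
    have : π x ∉ vars a₂ ∪ vars b₂ :=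
      Set.disjoint_left.1 hπ (ht (by rw [vars_relabel]; exact ⟨x, hx, rfl⟩))
    simp only [τ, Function.comp_apply, if_neg this, Equiv.symm_apply_apply]
  have hsub : vars s ⊆ vars a₂ := vars_subset_of_subtermAt hp
  have hτ : IsUnifier τ s (a₁.relabel π) := by
    rw [IsUnifier, hτ₂ s (hsub.trans Set.subset_union_left), hτ₁ a₁ Set.subset_union_left, hσ]
  rw [← hτ₂ a₂ Set.subset_union_left, ← hτ₂ b₂ Set.subset_union_right,
    ← hτ₁ b₁ Set.subset_union_right]
  by_cases hv : p = [] ∧ AreVariants (a₁.relabel π) (b₁.relabel π) a₂ b₂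
  · obtain ⟨rfl, π', ha, hb⟩ := hv
    have hsa : a₂ = s := by simpa using hp
    have hτ' : (a₁.relabel π).subst τ = (a₁.relabel π).subst (τ ∘ π') := by
      rw [← relabel_subst, ← ha, hsa]
      exact hτ.symm
    have hbb : (b₁.relabel π).subst τ = b₂.subst τ := by
      rw [hb, relabel_subst _ π']
      -- The two substitutions agree on the left-hand side, hence on the right-hand side by the
      -- variable condition, which needs `ε ≠ ⊥`.
      refine subst_congr fun x hx => eq_of_subst_eq hτ' x ?_
      rw [vars_relabel] at hx ⊢
      exact Set.image_mono (hvar a₁ ε b₁ h₁ hε) hx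
    rw [replaceAt_nil, hbb]
    refine le_trans ?_ (one_le_valley_self S.rel _)
    rw [hΩ.integral]
    exact le_top
  · obtain ⟨σ, hu, hmgu⟩ := exists_isMGU ((hlin a₂ δ b₂ h₂).1.subterm hp)
      ((hlin a₁ ε b₁ h₁).1.relabel π.injective)
      ((hπ.mono Set.subset_union_left (hsub.trans Set.subset_union_left)).symm) hτ
    have hρ : ∀ t : L.Term X, t.subst τ = (t.subst σ).subst τ := fun t => by
      rw [subst_subst]
      exact subst_congr fun x _ => hmgu τ hτ x
    have hcrit := hcp _ _ ⟨a₁.relabel π, ε, b₁.relabel π, a₂, δ, b₂, p, s, σ,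
      { rule₁ := ⟨a₁, b₁, π, h₁, rfl, rfl⟩
        rule₂ := ⟨a₂, b₂, Equiv.refl X, h₂, (relabel_id a₂).symm, (relabel_id b₂).symm⟩
        disjoint := hπ
        position := hp
        function_position := hs
        unifiable := ⟨τ, hτ⟩
        not_variants := fun h h' => hv ⟨h, h'⟩ },
      ⟨hu, fun τ hτ => ⟨τ, hmgu τ hτ⟩⟩, rfl, rfl⟩
    have hred₁ : S.Red ε (a₂.subst σ) (replaceAt (a₂.subst σ) p ((b₁.relabel π).subst σ)) := by
      refine Red.replaceAt (subtermAt_subst hp σ) ?_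
      rw [show s.subst σ = (a₁.relabel π).subst σ from hu, relabel_subst, relabel_subst]
      exact Red.root a₁ b₁ h₁ _
    have hred₂ : S.Red δ (a₂.subst σ) (b₂.subst σ) := Red.root a₂ b₂ h₂ σ
    rw [hρ a₂, hρ b₂, hρ (b₁.relabel π), ← replaceAt_subst (subtermAt_subst hp σ)]
    calc ε * δ ≤ _ := mul_le_mul' hred₁.le_rel hred₂.le_rel
      _ ≤ _ := le_iSup (fun c => dual S.rel _ c * S.rel c _) (a₂.subst σ)
      _ ≤ _ := hcrit
      _ ≤ _ := valley_map (rel_subst hcont τ) _ _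

/-- A contraction inside `σ x` leaves an instance of `a`, to which the rule still applies, with
weight `δ`. On the other side at most one contraction of weight `ε` reaches the same term because
`b` is linear; a repeated variable in `b` would cost a power of `ε`. Any other redex overlaps at a
function symbol. -/
theorem root_peak_le_valley [Countable X] [Infinite X] (hΩ : IsLawvereian Ω)
    (hcont : IsContinuousQuantale Ω) (hlin : S.Linear) (hvar : S.VariableCondition)
    (hcp : S.LocallyConfluentOnCriticalPairs) {a b g : L.Term X} (h : S.Rule a δ b)
    {σ : X → L.Term X} (hg : S.Red ε (a.subst σ) g) :
    ε * δ ≤ S.rel.valley g (b.subst σ) := by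
  classical
  rcases Red.of_subst (hlin a δ b h).1 hg with
    ⟨x, -, u, hu, rfl⟩ | ⟨p, s, a₁, b₁, τ, hp, hs, hr, hst, rfl⟩
  · rw [mul_comm]
    refine mul_le_valley (d := b.subst (Function.update σ x u))
      ((Red.root a b h _).le_rel.trans (le_star _ _ _)) ?_
    rcases Red.subst_update (hlin a δ b h).2 hu with h' | h'
    -- No step is needed here; by integrality the empty reduction has degree `⊤`, which absorbs `ε`.
    · rw [h']
      refine le_trans ?_ (one_le_star_self S.rel _)
      rw [hΩ.integral]
      exact le_top
    · exact h'.le_rel.trans (le_star _ _ _)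
  · exact overlap_le_valley hΩ hcont hlin hvar hcp hr h hp hs hst

/-- Descend into the term while both redexes lie in the same argument, carrying the valley back
through the context. The descent ends when one redex is at the root or the redexes lie in different
arguments and commute. -/
theorem peak_le_valley [Countable X] [Infinite X] (hΩ : IsLawvereian Ω)
    (hcont : IsContinuousQuantale Ω) (hlin : S.Linear) (hvar : S.VariableCondition)
    (hcp : S.LocallyConfluentOnCriticalPairs) {e f g : L.Term X} (hf : S.Red ε e f)
    (hg : S.Red δ e g) : ε * δ ≤ S.rel.valley f g := by
  induction hf generalizing g with
  | root a b h σ =>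
    rw [mul_comm, valley_comm]
    exact root_peak_le_valley hΩ hcont hlin hvar hcp h hg
  | @arg n f ts i t h ih =>
    generalize he : func f ts = e at hg
    cases hg with
    | root a b h' σ =>
      refine root_peak_le_valley hΩ hcont hlin hvar hcp h' ?_
      rw [← he]
      exact Red.arg f ts i t h
    | @arg m f' ts' j u hu =>
      injection he with h1 h2 h3
      subst h1
      obtain rfl := eq_of_heq h2
      obtain rfl := eq_of_heq h3
      by_cases hij : j = i
      · subst hij
        exact (ih hu).trans (valley_map (rel_arg hcont f ts j) t u)
      · rw [mul_comm]
        refine mul_le_valley (d := func f (Function.update (Function.update ts i t) j u)) ?_ ?_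
        · exact (Red.arg f _ j u (by rwa [Function.update_of_ne hij])).le_rel.trans (le_star _ _ _)
        · rw [← Function.update_comm hij]
          exact (Red.arg f _ i t (by rwa [Function.update_of_ne (Ne.symm hij)])).le_rel.trans
            (le_star _ _ _)

/-- The critical pair lemma for linear systems. -/
theorem locallyConfluent_of_criticalPairs [Countable X] [Infinite X] (hΩ : IsLawvereian Ω)
    (hcont : IsContinuousQuantale Ω) (hlin : S.Linear) (hvar : S.VariableCondition)
    (hcp : S.LocallyConfluentOnCriticalPairs) : S.rel.LocallyConfluent := by
  refine fun f g => iSup_le fun e => ?_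
  rw [dual, rel_eq hcont, rel_eq hcont, sSup_mul_distrib]
  refine iSup₂_le fun ε hε => ?_
  rw [mul_sSup_distrib]
  exact iSup₂_le fun δ hδ => peak_le_valley hΩ hcont hlin hvar hcp hε hδ

/-- The critical pair theorem for linear systems. -/
theorem confluent_of_criticalPairs [Countable X] [Infinite X] (hΩ : IsLawvereian Ω)
    (hcont : IsContinuousQuantale Ω) (hlin : S.Linear) (ht : S.rel.Terminating)
    (hcp : S.LocallyConfluentOnCriticalPairs) : S.rel.Confluent :=
  confluent_of_terminating hΩ ht (locallyConfluent_of_criticalPairs hΩ hcont hlin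
    (variableCondition_of_terminating hΩ hcont ht) hcp)

end QTRS

/-! ### A duplicating system -/

namespace Duplication

open QTerm QRel FirstOrder.Language FirstOrder.Language.Term

/-- The function symbols of the duplicating system. -/
inductive Symbol : ℕ → Type
  | a : Symbol 0
  | b : Symbol 0
  | g : Symbol 1
  | f : Symbol 2

/-- The signature of the duplicating system. -/
abbrev signature : FirstOrder.Language.{0, 0} := ⟨Symbol, fun _ => Empty⟩

variable {X : Type*} {Ω : Type w}

/-- The constant `a`. -/
def a : signature.Term X := func (L := signature) Symbol.a ![]

/-- The constant `b`. -/
def b : signature.Term X := func (L := signature) Symbol.b ![]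

/-- The term `g(t)`. -/
def g (t : signature.Term X) : signature.Term X := func (L := signature) Symbol.g ![t]

/-- The term `f(s, t)`. -/
def f (s t : signature.Term X) : signature.Term X := func (L := signature) Symbol.f ![s, t]

/-- The rules `a ↦ b`, of weight `ε`, and `g(x) ↦ f(x, x)`, of weight `⊤`. -/
def system [CompleteLattice Ω] (ε : Ω) (x : X) : QTRS signature X Ω where
  Rule s δ t := (s = a ∧ t = b ∧ δ ≤ ε) ∨ (s = g (var x) ∧ t = f (var x) (var x))
  antitone _ _ _ _ hle h := h.imp (fun ⟨hs, ht, h⟩ => ⟨hs, ht, hle.trans h⟩) id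

@[simp] theorem subst_a (σ : X → signature.Term X) : (a : signature.Term X).subst σ = a := by
  simp only [a, subst_func]; congr 1; funext i; exact i.elim0

@[simp] theorem subst_b (σ : X → signature.Term X) : (b : signature.Term X).subst σ = b := by
  simp only [b, subst_func]; congr 1; funext i; exact i.elim0

@[simp] theorem subst_g (t : signature.Term X) (σ : X → signature.Term X) :
    (g t).subst σ = g (t.subst σ) := by
  simp only [g, subst_func]; congr 1; funext i; fin_cases i; rfl

@[simp] theorem subst_f (s t : signature.Term X) (σ : X → signature.Term X) :
    (f s t).subst σ = f (s.subst σ) (t.subst σ) := by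
  simp only [f, subst_func]; congr 1; funext i; fin_cases i <;> rfl

@[simp] theorem vars_g (t : signature.Term X) : vars (g t) = vars t := by
  rw [g, vars_func]; ext; simp

@[simp] theorem vars_f (s t : signature.Term X) : vars (f s t) = vars s ∪ vars t := by
  rw [f, vars_func]; ext; simp [Fin.exists_fin_two]

/-- A measure which all reductions decrease. -/
def measure : signature.Term X → ℕ
  | var _ => 0
  | func Symbol.a _ => 1
  | func Symbol.b _ => 0
  -- This exceeds by one the measure of `f(t, t)`, so duplication decreases it.
  | func Symbol.g ts => 2 * measure (ts 0) + 1
  | func Symbol.f ts => measure (ts 0) + measure (ts 1)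

/-- The number of occurrences of `a`. -/
def count : signature.Term X → ℕ
  | var _ => 0
  | func Symbol.a _ => 1
  | func Symbol.b _ => 0
  | func Symbol.g ts => count (ts 0)
  | func Symbol.f ts => count (ts 0) + count (ts 1)

section

variable [CompleteLattice Ω] {ε δ : Ω} {x : X}

/-- The three invariants serve termination, the price of at least one factor `ε` for each lost `a`,
and the fact that `a` never appears in an `a`-free term. -/
theorem red_measure_count {s t : signature.Term X} (h : (system ε x).Red δ s t) :
    measure t < measure s ∧ (count s ≤ count t ∨ δ ≤ ε ∧ count s ≤ count t + 1) ∧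
      (count s = 0 → count t = 0) := by
  induction h with
  | root l r h σ =>
    rcases h with ⟨rfl, rfl, h⟩ | ⟨rfl, rfl⟩
    · simp [a, b, measure, count, h]
    · simp [g, f, measure, count]; omega
  | arg c ts i t h ih =>
    cases c with
    | a => exact i.elim0
    | b => exact i.elim0
    | g =>
      obtain rfl : i = 0 := Subsingleton.elim _ _
      simpa [measure, count] using ih
    | f =>
      have hi : i = 0 ∨ i = 1 := by omega
      rcases hi with rfl | rfl <;> simp [measure, count] <;>
      exact ⟨ih.1, by rcases ih.2.1 with h | h <;> [left; (right; refine ⟨h.1, ?_⟩)] <;> omega,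
        by omega⟩

theorem red_g (t : signature.Term X) : (system ε x).Red δ (g t) (f t t) := by
  simpa using QTRS.Red.root (S := system ε x) (ε := δ) (g (var x)) (f (var x) (var x))
    (Or.inr ⟨rfl, rfl⟩) (fun _ => t)

theorem red_g_a : (system ε x).Red ε (g a) (g b) := by
  have h := QTRS.Red.root (S := system ε x) (ε := ε) a b (Or.inl ⟨rfl, rfl, le_rfl⟩) var
  rw [subst_a, subst_b] at h
  have h' := QTRS.Red.arg (S := system ε x) (ε := ε) (Symbol.g : signature.Functions 1) ![a] 0 b h
  have : Function.update ![(a : signature.Term X)] 0 b = ![b] := by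
    funext i; fin_cases i; simp
  rwa [this] at h'

theorem not_linear (ε : Ω) (x : X) : ¬ (system ε x).Linear := by
  intro h
  have := (h (g (var x)) ⊥ (f (var x) (var x)) (Or.inr ⟨rfl, rfl⟩)).2 x [0] [1] rfl rfl
  simp at this

theorem variableCondition (ε : Ω) (x : X) : (system ε x).VariableCondition := by
  rintro s δ t (⟨rfl, rfl, -⟩ | ⟨rfl, rfl⟩) -
  · simp [a, b]
  · simp

/-- The only function position of either left-hand side is its root. There, distinct rules clash in
their symbols and equal rules are variants. -/
theorem not_isOverlap {c₁ d₁ c₂ d₂ s : signature.Term X} {δ₁ δ₂ : Ω} {p : List ℕ} :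
    ¬ (system ε x).IsOverlap c₁ δ₁ d₁ c₂ δ₂ d₂ p s := by
  rintro ⟨⟨l₁, r₁, π₁, h₁, rfl, rfl⟩, ⟨l₂, r₂, π₂, h₂, rfl, rfl⟩, -, hp, hs, ⟨σ, hσ⟩, hv⟩
  have hp' : p = [] := by
    rcases p with _ | ⟨k, p⟩
    · rfl
    rcases h₂ with ⟨rfl, -⟩ | ⟨rfl, -⟩
    · obtain ⟨i, -⟩ := subtermAt_func_cons_eq_some.1 hp
      exact i.elim0
    · obtain ⟨i, -, hi⟩ := subtermAt_func_cons_eq_some.1 hp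
      obtain rfl : i = 0 := Subsingleton.elim _ _
      rcases p with _ | ⟨j, p⟩
      · exact (hs (π₂ x) (by simpa [relabel] using hi.symm)).elim
      · simp [relabel] at hi
  subst hp'
  obtain rfl : relabel π₂ l₂ = s := by simpa using hp
  have heq : l₁ = l₂ ∧ r₁ = r₂ := by
    rw [IsUnifier, relabel_subst, relabel_subst] at hσ
    rcases h₁ with ⟨rfl, rfl, -⟩ | ⟨rfl, rfl⟩ <;> rcases h₂ with ⟨rfl, rfl, -⟩ | ⟨rfl, rfl⟩
    · exact ⟨rfl, rfl⟩
    · simp [a, g] at hσ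
    · simp [a, g] at hσ
    · exact ⟨rfl, rfl⟩
  obtain ⟨rfl, rfl⟩ := heq
  exact hv rfl ⟨π₁.symm.trans π₂, by simp [Function.comp_def], by simp [Function.comp_def]⟩

theorem exists_red_of_rel_ne_bot (hcont : IsContinuousQuantale Ω) {s t : signature.Term X}
    (h : (system ε x).rel s t ≠ ⊥) : ∃ δ, (system ε x).Red δ s t := by
  by_contra! h'
  rw [QTRS.rel_eq hcont, Set.eq_empty_of_forall_notMem (s := {δ | (system ε x).Red δ s t}) h',
    sSup_empty] at h
  exact h rfl

end

section

variable [CommMonoid Ω] [CompleteLattice Ω] {ε : Ω} {x : X}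

theorem locallyConfluentOnCriticalPairs (ε : Ω) (x : X) :
    (system ε x).LocallyConfluentOnCriticalPairs := by
  rintro t₁ t₂ ⟨c₁, δ₁, d₁, c₂, δ₂, d₂, p, s, σ, h, -⟩
  exact (not_isOverlap h).elim

variable [IsQuantale Ω]

theorem terminating (hcont : IsContinuousQuantale Ω) (ε : Ω) (x : X) :
    (system ε x).rel.Terminating := by
  intro s hs
  have hlt : ∀ n, measure (s (n + 1)) < measure (s n) := by
    intro n
    obtain ⟨δ, h⟩ := exists_red_of_rel_ne_bot hcont (ε := ε) (x := x) (s := s n) (t := s (n + 1))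
      fun h => hs (n + 1) (by rw [Finset.prod_range_succ, h, Quantale.mul_bot])
    exact (red_measure_count h).1
  have hle : ∀ n, measure (s n) + n ≤ measure (s 0) := by
    intro n
    induction n with
    | zero => simp
    | succ n ih => have := hlt n; omega
  have := hle (measure (s 0) + 1)
  omega

/-- `ε ^ count t` is a potential: a step either does not lower the count, or lowers it by one and
contributes a factor at most `ε`. -/
theorem star_mul_pow_count_le (hΩ : IsLawvereian Ω) (hcont : IsContinuousQuantale Ω)
    (s t : signature.Term X) : (system ε x).rel.star s t * ε ^ count t ≤ ε ^ count s := by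
  have hle : ∀ δ : Ω, δ ≤ 1 := fun δ => by rw [hΩ.integral]; exact le_top
  refine star_mul_le (x := fun t => ε ^ count t) (fun s t => ?_) s t
  rw [QTRS.rel_eq hcont, sSup_mul_distrib]
  refine iSup₂_le fun δ hδ => ?_
  rcases (red_measure_count hδ).2.1 with h | ⟨h, h'⟩
  · exact (mul_le_of_le_one_left' (hle δ)).trans (pow_le_pow_right_of_le_one' (hle ε) h)
  · calc δ * ε ^ count t ≤ ε * ε ^ count t := mul_le_mul_left h _
      _ = ε ^ (count t + 1) := (pow_succ' _ _).symm
      _ ≤ ε ^ count s := pow_le_pow_right_of_le_one' (hle ε) h'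

/-- The same potential argument, with the potential `⊥` on `a`-free terms and `1` elsewhere. -/
theorem star_eq_bot_of_count (hΩ : IsLawvereian Ω) (hcont : IsContinuousQuantale Ω) {s t : signature.Term X}
    (hs : count s = 0) (ht : count t ≠ 0) : (system ε x).rel.star s t = ⊥ := by
  have h := star_mul_le (R := (system ε x).rel) (x := fun t => if count t = 0 then ⊥ else (1 : Ω))
    (fun s t => ?_) s t
  · simpa [hs, ht] using h
  · by_cases hs : count s = 0
    · by_cases ht : count t = 0
      · simp [ht]
      · have : (system ε x).rel s t = ⊥ := by
          by_contra hne
          obtain ⟨δ, h⟩ := exists_red_of_rel_ne_bot hcont hne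
          exact ht ((red_measure_count h).2.2 hs)
        simp [this]
    · simp only [if_neg hs, hΩ.integral]
      exact le_top

theorem not_locallyConfluent (hΩ : IsLawvereian Ω) (hcont : IsContinuousQuantale Ω)
    (hε : ε * ε ≠ ε) (x : X) : ¬ (system ε x).rel.LocallyConfluent := by
  have hle : ∀ δ : Ω, δ ≤ 1 := fun δ => by rw [hΩ.integral]; exact le_top
  intro h
  refine hε (le_antisymm (mul_le_of_le_one_left' (hle ε)) ?_)
  have hvalley : (system ε x).rel.valley (g b) (f a a) ≤ ε * ε := by
    refine iSup_le fun t => ?_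
    -- A common reduct of nonzero degree is `a`-free because `g(b)` is, so `f(a, a)` has to lose
    -- both copies of `a` on the way to it.
    by_cases ht : count t = 0
    · have := star_mul_pow_count_le hΩ hcont (ε := ε) (x := x) (f a a) t
      rw [ht, pow_zero, mul_one] at this
      refine (mul_le_of_le_one_left' (hle _)).trans (this.trans_eq ?_)
      simp [f, a, count, pow_two]
    · rw [star_eq_bot_of_count hΩ hcont (by simp [g, b, count]) ht, Quantale.bot_mul]
      exact bot_le
  calc ε = ε * 1 := (mul_one ε).symm
    _ ≤ (system ε x).rel (g a) (g b) * (system ε x).rel (g a) (f a a) :=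
      mul_le_mul' red_g_a.le_rel (red_g a).le_rel
    _ ≤ _ := le_iSup (fun t => dual (system ε x).rel (g b) t * (system ε x).rel t (f a a)) (g a)
    _ ≤ _ := h _ _
    _ ≤ ε * ε := hvalley

end

end Duplication

/-- Critical pair theorem and critical pair lemma for linear quantale-valued term rewriting systems,
and the failure of both without linearity over each non-idempotent quantale. -/
theorem mainTheorem1 {Ω : Type w} [CommMonoid Ω] [CompleteLattice Ω] [IsQuantale Ω]
    (hΩ : IsLawvereian Ω) (hcont : IsContinuousQuantale Ω)
    (X : Type*) [Countable X] [Infinite X] :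
    (∀ (L : FirstOrder.Language.{u, v}) (S : QTRS L X Ω), S.Linear → S.rel.Terminating →
      S.LocallyConfluentOnCriticalPairs → S.rel.Confluent) ∧
    (∀ (L : FirstOrder.Language.{u, v}) (S : QTRS L X Ω), S.Linear → S.VariableCondition →
      S.LocallyConfluentOnCriticalPairs → S.rel.LocallyConfluent) ∧
    ((¬ ∀ ε : Ω, ε * ε = ε) →
      ∃ (L : FirstOrder.Language.{0, 0}) (S : QTRS L X Ω), ¬ S.Linear ∧ S.VariableCondition ∧
        S.rel.Terminating ∧ S.LocallyConfluentOnCriticalPairs ∧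
        ¬ S.rel.LocallyConfluent ∧ ¬ S.rel.Confluent) := by
  refine ⟨fun L S hlin ht hcp => QTRS.confluent_of_criticalPairs hΩ hcont hlin ht hcp,
    fun L S hlin hvar hcp => QTRS.locallyConfluent_of_criticalPairs hΩ hcont hlin hvar hcp,
    fun h => ?_⟩
  obtain ⟨ε, hε⟩ := not_forall.1 h
  obtain ⟨x⟩ : Nonempty X := inferInstance
  have hnot := Duplication.not_locallyConfluent hΩ hcont hε x
  exact ⟨Duplication.signature, Duplication.system ε x, Duplication.not_linear ε x,
    Duplication.variableCondition ε x, Duplication.terminating hcont ε x,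
    Duplication.locallyConfluentOnCriticalPairs ε x, hnot,
    fun hc => hnot (QRel.locallyConfluent_of_confluent hc)⟩
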